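/- Let $s$ be an integer with $|s|\ge 3$, let $t\ge 1$ be an integer with $\gcd(s,t)=1$, and put \[ \alpha=\prod_{p\mid s} p^{1/(p-1)},\qquad \varepsilon(N)=\frac{\log\log\log N}{\log\log N},\qquad z_0(y)=y,\quad z_k(y)=\frac{y}{\log z_{k-1}(y)}\ \ (k\ge 1), \] where the product runs over the prime divisors $p$ of $s$. (1) For every $\varepsilon_3>0$ there exists an integer $N_3\ge 1$ such that \[ 1<\left|e^{s/t}-\frac{M}{N}\right|\,N^{2+2\log(|s|/\alpha)\,(1+(1+\varepsilon_3)\varepsilon(N))/\log\log N} \] for all integers $M\neq 0$ and all integers $N\ge N_3$. (2) For every integer $n\ge 2$ there exist a real number $c_3>0$ and an integer $N_3\ge 1$ such that \[ 1<\left|e^{s/t}-\frac{M}{N}\right|\,N^{2+2\log(|s|/\alpha)\,\left(1/\log z_{n-1}(\log N)+c_3/(\log\log N)^2\right)} \] for all integers $M\neq 0$ and all integers $N\ge N_3$. Here $N_3$ and $c_3$ may depend on $s$, $t$ and on $\varepsilon_3$ (respectively $n$), but not on $M$ or $N$. -/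

import Mathlib

namespace ExpApprox

/-- `α = ∏ p ^ (1 / (p - 1))`, the product over the prime divisors `p` of the integer `s`. -/
noncomputable def alpha (s : ℤ) : ℝ :=
  ∏ p ∈ s.natAbs.primeFactors, (p : ℝ) ^ (1 / ((p : ℝ) - 1))

/-- `z₀(y) = y` and `zₙ(y) = y / log zₙ₋₁(y)` for `n ≥ 1`. -/
noncomputable def zIter : ℕ → ℝ → ℝ
  | 0, y => y
  | n + 1, y => y / Real.log (zIter n y)

/-- `ε(N) = log log log N / log log N`. -/
noncomputable def eps (N : ℕ) : ℝ :=
  Real.log (Real.log (Real.log N)) / Real.log (Real.log N)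

end ExpApprox

/-!
The bound comes from the diagonal Padé approximants to `exp` at `s / t`. Homogenised, they give
integers `Q n`, `P n` such that `Q n * exp (s / t) - P n` is tiny: the remainder is an explicit
power series (`pade_remainder`), found by induction because it satisfies the same three-term
recurrence `pade_add_two` as `Q` and `P`. All the coefficients share the factor
`∏ p ^ v_p(n!)` over the primes `p ∣ s` (`factorialPart_dvd`), which by Legendre's formula is
at least `α ^ n` divided by a polynomial in `n` (`alpha_pow_le`). After dividing by it,
the `n`-th denominator is at most `denBound n` and the `n`-th remainder at most `remBound n`, and
the product of these two bounds is `(|s| / α) ^ (2n)` times a polynomial.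

Given `N`, let `m` be the last index with `2 * N * remBound m ≥ 1`. Both approximants of orders
`m + 1` and `m + 2` have small remainders, and they are distinct because their determinant does not
vanish (`pade_det`), so one of them differs from `M / N`. This gives
`|exp (s / t) - M / N| ≥ 1 / (2 * N * denBound)`, that is, a lower bound by
`N ^ (-2) * (|s| / α) ^ (-2m)` up to a polynomial in `m` (`exists_order_lower_bound`).

Since `remBound m` is `m ^ (-m)` up to an exponential factor, `m log m ≤ log N + O(m)`, and hence,
with `L = log log N`, `m ≤ (1 / (L - log L) + O(1 / L ^ 2)) * log N` (`le_of_mul_log_le`). As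
`|s| / α > 1` (`alpha_lt`, where `|s| ≥ 3` is needed), the slack `log N / L ^ 2` absorbs all the
polynomial factors. Finally `1 / (L - log L) = 1 / L + log L / L ^ 2 + ⋯` lies below the first
exponent, and `log z_k(log N) = L - log L + O(1)` for `k ≥ 1` gives the second.
-/

namespace ExpApprox

open Finset Filter Topology

/-! ### Homogenised Padé polynomials -/

/-- The Padé coefficient `(2m + k)! / (k! m!)`, written as a natural number. -/
def padeCoeff (m k : ℕ) : ℕ := (2 * m + k).choose m * (m + k).descFactorial m

/-- The homogenised numerator `∑ (2m + k)! / (k! m!) * t ^ m * x ^ k`, over `m + k = n`, of the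
diagonal Padé approximant of order `n` to `exp` at `x / t`. The denominator is
`pade (-x) t n`. -/
noncomputable def pade (x t : ℝ) (n : ℕ) : ℝ :=
  ∑ p ∈ antidiagonal n, (padeCoeff p.1 p.2 : ℝ) * t ^ p.1 * x ^ p.2

lemma padeCoeff_mul_factorial (m k : ℕ) :
    padeCoeff m k * (k.factorial * m.factorial) = (2 * m + k).factorial := by
  have h1 := Nat.choose_mul_factorial_mul_factorial (n := 2 * m + k) (k := m) (by omega)
  have h2 := Nat.factorial_mul_descFactorial (n := m + k) (k := m) (by omega)
  rw [show 2 * m + k - m = m + k by omega] at h1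
  rw [show m + k - m = k by omega] at h2
  rw [padeCoeff, ← h1, ← h2]
  ring

lemma padeCoeff_eq (m k : ℕ) :
    (padeCoeff m k : ℝ) = (2 * m + k).factorial / (k.factorial * m.factorial) := by
  rw [eq_div_iff (by positivity)]
  exact_mod_cast padeCoeff_mul_factorial m k

lemma padeCoeff_zero_left (k : ℕ) : padeCoeff 0 k = 1 := by simp [padeCoeff]

lemma padeCoeff_succ_zero (m : ℕ) :
    (padeCoeff (m + 1) 0 : ℝ) = (4 * m + 2) * padeCoeff m 0 := by
  simp only [padeCoeff_eq, show 2 * (m + 1) + 0 = 2 * m + 1 + 1 by ring, Nat.factorial_succ,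
    add_zero]
  push_cast
  field_simp
  ring

lemma padeCoeff_succ_one (m : ℕ) :
    (padeCoeff (m + 1) 1 : ℝ) = (4 * m + 6) * padeCoeff m 1 := by
  simp only [padeCoeff_eq, show 2 * (m + 1) + 1 = 2 * m + 1 + 1 + 1 by ring, Nat.factorial_succ]
  push_cast
  field_simp
  ring

lemma padeCoeff_succ_add_two (m k : ℕ) :
    (padeCoeff (m + 1) (k + 2) : ℝ) =
      (4 * (m + k) + 10) * padeCoeff m (k + 2) + padeCoeff (m + 1) k := by
  simp only [padeCoeff_eq, show 2 * (m + 1) + (k + 2) = 2 * m + k + 1 + 1 + 1 + 1 by ring,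
    show 2 * m + (k + 2) = 2 * m + k + 1 + 1 by ring,
    show 2 * (m + 1) + k = 2 * m + k + 1 + 1 by ring, Nat.factorial_succ]
  push_cast
  field_simp
  ring

lemma pade_zero (x t : ℝ) : pade x t 0 = 1 := by simp [pade, padeCoeff]

lemma pade_one (x t : ℝ) : pade x t 1 = 2 * t + x := by
  simp [pade, Finset.Nat.sum_antidiagonal_succ, padeCoeff]
  ring

/-- The three-term recurrence of the diagonal Padé approximants to `exp`. -/
lemma pade_add_two (x t : ℝ) (n : ℕ) :
    pade x t (n + 2) = (4 * n + 6) * t * pade x t (n + 1) + x ^ 2 * pade x t n := by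
  -- Split off `m = 0`, `k = 0` and `k = 1`; `padeCoeff_succ_add_two` handles the other terms.
  have h2 : pade x t (n + 2) = x ^ (n + 2) + (padeCoeff (n + 2) 0 * t ^ (n + 2)
      + ∑ p ∈ antidiagonal n,
        (padeCoeff (p.1 + 1) (p.2 + 1) : ℝ) * t ^ (p.1 + 1) * x ^ (p.2 + 1)) := by
    rw [pade, Finset.Nat.sum_antidiagonal_succ, Finset.Nat.sum_antidiagonal_succ']
    simp [padeCoeff_zero_left]
  have h1 : pade x t (n + 1) = padeCoeff (n + 1) 0 * t ^ (n + 1)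
      + ∑ p ∈ antidiagonal n,
        (padeCoeff p.1 (p.2 + 1) : ℝ) * t ^ p.1 * x ^ (p.2 + 1) := by
    rw [pade, Finset.Nat.sum_antidiagonal_succ']
    simp
  rw [h2, h1, padeCoeff_succ_zero (n + 1)]
  cases n with
  | zero => simp [pade, padeCoeff]; ring
  | succ n =>
    have h0 : pade x t (n + 1) = x ^ (n + 1) + ∑ p ∈ antidiagonal n,
        (padeCoeff (p.1 + 1) p.2 : ℝ) * t ^ (p.1 + 1) * x ^ p.2 := by
      rw [pade, Finset.Nat.sum_antidiagonal_succ]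
      simp [padeCoeff_zero_left]
    have key : ∑ p ∈ antidiagonal n,
          (padeCoeff (p.1 + 1) (p.2 + 2) : ℝ) * t ^ (p.1 + 1) * x ^ (p.2 + 2)
        = (4 * (n : ℝ) + 10) * t * ∑ p ∈ antidiagonal n,
          (padeCoeff p.1 (p.2 + 2) : ℝ) * t ^ p.1 * x ^ (p.2 + 2)
        + x ^ 2 * ∑ p ∈ antidiagonal n,
          (padeCoeff (p.1 + 1) p.2 : ℝ) * t ^ (p.1 + 1) * x ^ p.2 := by
      rw [Finset.mul_sum, Finset.mul_sum, ← Finset.sum_add_distrib]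
      refine Finset.sum_congr rfl fun p hp => ?_
      have hn : (n : ℝ) = p.1 + p.2 := by exact_mod_cast (mem_antidiagonal.mp hp).symm
      rw [padeCoeff_succ_add_two, hn]
      ring
    rw [h0, Finset.Nat.sum_antidiagonal_succ', Finset.Nat.sum_antidiagonal_succ']
    simp only [zero_add, add_assoc, Nat.reduceAdd] at key ⊢
    rw [key]
    have h3 := padeCoeff_succ_one (n + 1)
    simp only [add_assoc, Nat.reduceAdd] at h3
    rw [h3]
    push_cast
    ring

/-- Consecutive Padé approximants are distinct: the determinant of two of them only changes by a
factor `-x ^ 2` from one index to the next. -/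
lemma pade_det (x t : ℝ) (n : ℕ) :
    pade (-x) t n * pade x t (n + 1) - pade (-x) t (n + 1) * pade x t n
      = (-1) ^ n * 2 * x ^ (2 * n + 1) := by
  induction n with
  | zero => simp [pade_zero, pade_one]; ring
  | succ n ih =>
    rw [pade_add_two, pade_add_two, show (-1 : ℝ) ^ (n + 1) * 2 * x ^ (2 * (n + 1) + 1)
      = -x ^ 2 * ((-1) ^ n * 2 * x ^ (2 * n + 1)) by ring, ← ih]
    ring

/-! ### The remainder -/

/-- The coefficients of the power series of the Padé remainder. -/
noncomputable def remCoeff (n j : ℕ) : ℝ :=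
  (n + j).factorial / (j.factorial * (2 * n + 1 + j).factorial)

/-- The power series of the Padé remainder, with its leading factor `± z ^ (2n + 1)` removed. -/
noncomputable def remSeries (n : ℕ) (z : ℝ) : ℝ := ∑' j, remCoeff n j * z ^ j

lemma remCoeff_nonneg (n j : ℕ) : 0 ≤ remCoeff n j := by unfold remCoeff; positivity

lemma remCoeff_le (n j : ℕ) :
    remCoeff n j ≤ (n.factorial / (2 * n + 1).factorial : ℝ) / j.factorial := by
  have h : (n + j).factorial * (2 * n + 1).factorial
      ≤ n.factorial * (2 * n + 1 + j).factorial := by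
    induction j with
    | zero => simp
    | succ j ih =>
      rw [← add_assoc n, ← add_assoc (2 * n + 1), Nat.factorial_succ,
        Nat.factorial_succ (2 * n + 1 + j)]
      calc (n + j + 1) * (n + j).factorial * (2 * n + 1).factorial
          = (n + j + 1) * ((n + j).factorial * (2 * n + 1).factorial) := by ring
        _ ≤ (2 * n + 1 + j + 1) * (n.factorial * (2 * n + 1 + j).factorial) :=
            Nat.mul_le_mul (by omega) ih
        _ = _ := by ring
  unfold remCoeff
  rw [div_div, div_le_div_iff₀ (by positivity) (by positivity)]
  have h' : ((n + j).factorial : ℝ) * (2 * n + 1).factorial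
      ≤ n.factorial * (2 * n + 1 + j).factorial := by exact_mod_cast h
  nlinarith [mul_le_mul_of_nonneg_left h' (Nat.cast_nonneg (α := ℝ) j.factorial)]

lemma hasSum_pow_div_factorial (z : ℝ) :
    HasSum (fun j : ℕ => z ^ j / (j.factorial : ℝ)) (Real.exp z) := by
  rw [Real.exp_eq_exp_ℝ]
  exact NormedSpace.expSeries_div_hasSum_exp z

lemma abs_remCoeff_mul_pow_le (n j : ℕ) (z : ℝ) :
    |remCoeff n j * z ^ j|
      ≤ (n.factorial / (2 * n + 1).factorial : ℝ) * (|z| ^ j / j.factorial) := by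
  rw [abs_mul, abs_pow, abs_of_nonneg (remCoeff_nonneg n j)]
  calc remCoeff n j * |z| ^ j
      ≤ (n.factorial / (2 * n + 1).factorial : ℝ) / j.factorial * |z| ^ j := by
        gcongr
        exact remCoeff_le n j
    _ = _ := by ring

lemma hasSum_remSeries (n : ℕ) (z : ℝ) :
    HasSum (fun j => remCoeff n j * z ^ j) (remSeries n z) :=
  (Summable.of_norm_bounded ((hasSum_pow_div_factorial |z|).summable.mul_left _)
    fun j => abs_remCoeff_mul_pow_le n j z).hasSum

lemma abs_remSeries_le (n : ℕ) (z : ℝ) :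
    |remSeries n z| ≤ (n.factorial / (2 * n + 1).factorial : ℝ) * Real.exp |z| := by
  rw [remSeries, ← Real.norm_eq_abs]
  exact tsum_of_norm_bounded ((hasSum_pow_div_factorial |z|).mul_left _)
    fun j => abs_remCoeff_mul_pow_le n j z

lemma hasSum_of_shift {f g : ℕ → ℝ} {a b : ℝ} (k : ℕ) (hf : HasSum f b)
    (hab : a + ∑ i ∈ range k, f i = b) (h : ∀ j, g j = f (j + k)) : HasSum g a := by
  subst hab
  rw [funext h]
  exact (hasSum_nat_add_iff k).mpr hf

lemma mul_remSeries_zero (z : ℝ) : z * remSeries 0 z = Real.exp z - 1 := by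
  refine ((hasSum_remSeries 0 z).mul_left z).unique ?_
  refine hasSum_of_shift 1 (hasSum_pow_div_factorial z) (by simp) fun j => ?_
  simp only [remCoeff, show 2 * 0 + 1 + j = j + 1 by ring, zero_add]
  field_simp
  ring

lemma sq_mul_remSeries_one (z : ℝ) :
    z ^ 2 * remSeries 1 z = Real.exp z + 1 - 2 * remSeries 0 z := by
  refine ((hasSum_remSeries 1 z).mul_left (z ^ 2)).unique ?_
  have hg := (hasSum_pow_div_factorial z).sub ((hasSum_remSeries 0 z).mul_left 2)
  refine hasSum_of_shift 2 hg ?_ fun j => ?_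
  · simp [sum_range_succ, remCoeff]
    ring
  · have e : 1 / ((j + 2).factorial : ℝ) - 2 * remCoeff 0 (j + 2) = remCoeff 1 j := by
      simp only [remCoeff, show 1 + j = j + 1 by ring, zero_add,
        show 2 * 0 + 1 + (j + 2) = j + 1 + 1 + 1 by ring,
        show 2 * 1 + 1 + j = j + 1 + 1 + 1 by ring, Nat.factorial_succ]
      push_cast
      field_simp
      ring
    rw [← e]
    ring

/-- The power series counterpart of `pade_add_two`. -/
lemma sq_mul_remSeries_add_two (n : ℕ) (z : ℝ) :
    z ^ 2 * remSeries (n + 2) z = remSeries n z - (4 * n + 6) * remSeries (n + 1) z := by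
  refine ((hasSum_remSeries (n + 2) z).mul_left (z ^ 2)).unique ?_
  have hg := (hasSum_remSeries n z).sub ((hasSum_remSeries (n + 1) z).mul_left (4 * (n : ℝ) + 6))
  refine hasSum_of_shift 2 hg ?_ fun j => ?_
  · have e0 : remCoeff n 0 = (4 * (n : ℝ) + 6) * remCoeff (n + 1) 0 := by
      simp only [remCoeff, show 2 * (n + 1) + 1 + 0 = 2 * n + 1 + 1 + 1 by ring,
        Nat.factorial_succ, add_zero]
      push_cast
      field_simp
      ring
    have e1 : remCoeff n 1 = (4 * (n : ℝ) + 6) * remCoeff (n + 1) 1 := by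
      simp only [remCoeff, show 2 * (n + 1) + 1 + 1 = 2 * n + 1 + 1 + 1 + 1 by ring,
        Nat.factorial_succ]
      push_cast
      field_simp
      ring
    simp only [sum_range_succ, sum_range_zero, e0, e1]
    ring
  · have e : remCoeff n (j + 2) - (4 * (n : ℝ) + 6) * remCoeff (n + 1) (j + 2)
        = remCoeff (n + 2) j := by
      simp only [remCoeff, show n + (j + 2) = n + j + 1 + 1 by ring,
        show n + 1 + (j + 2) = n + j + 1 + 1 + 1 by ring, show n + 2 + j = n + j + 1 + 1 by ring,
        show 2 * n + 1 + (j + 2) = 2 * n + j + 1 + 1 + 1 by ring,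
        show 2 * (n + 1) + 1 + (j + 2) = 2 * n + j + 1 + 1 + 1 + 1 + 1 by ring,
        show 2 * (n + 2) + 1 + j = 2 * n + j + 1 + 1 + 1 + 1 + 1 by ring, Nat.factorial_succ]
      push_cast
      field_simp
      ring
    rw [← e]
    ring

lemma pade_remainder (t z : ℝ) (n : ℕ) :
    pade (-(t * z)) t n * Real.exp z - pade (t * z) t n
      = (-1) ^ n * t ^ n * z ^ (2 * n + 1) * remSeries n z := by
  induction n using Nat.twoStepInduction with
  | zero => simp [pade_zero, mul_remSeries_zero]
  | one =>
    rw [pade_one, pade_one]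
    linear_combination t * z * sq_mul_remSeries_one z - 2 * t * mul_remSeries_zero z
  | more n ih0 ih1 =>
    rw [pade_add_two, pade_add_two]
    linear_combination (4 * (n : ℝ) + 6) * t * ih1 + t ^ 2 * z ^ 2 * ih0
      - (-1) ^ n * t ^ (n + 2) * z ^ (2 * n + 3) * sq_mul_remSeries_add_two n z

/-! ### Size of the approximants -/

lemma padeCoeff_le (m k : ℕ) :
    (padeCoeff m k : ℝ) ≤ ((2 * (m + k)).factorial / (m + k).factorial : ℝ) / k.factorial := by
  have h : (2 * m + k).factorial * (m + k).factorial
      ≤ (2 * m + k + k).factorial * m.factorial := by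
    suffices H : ∀ j, (2 * m + k).factorial * (m + j).factorial
      ≤ (2 * m + k + j).factorial * m.factorial from H k
    intro j
    induction j with
    | zero => simp
    | succ j ih =>
      rw [← add_assoc, ← add_assoc, Nat.factorial_succ, Nat.factorial_succ]
      calc (2 * m + k).factorial * ((m + j + 1) * (m + j).factorial)
          = (m + j + 1) * ((2 * m + k).factorial * (m + j).factorial) := by ring
        _ ≤ (2 * m + k + j + 1) * ((2 * m + k + j).factorial * m.factorial) :=
            Nat.mul_le_mul (by omega) ih
        _ = _ := by ring
  have h' : ((2 * m + k).factorial : ℝ) * (m + k).factorial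
      ≤ (2 * (m + k)).factorial * m.factorial := by
    rw [show 2 * (m + k) = 2 * m + k + k by ring]
    exact_mod_cast h
  rw [padeCoeff_eq, div_div, div_le_div_iff₀ (by positivity) (by positivity)]
  nlinarith [mul_le_mul_of_nonneg_left h' (Nat.cast_nonneg (α := ℝ) k.factorial)]

lemma abs_pade_le (x t : ℝ) (ht : 0 < t) (n : ℕ) :
    |pade x t n| ≤ ((2 * n).factorial / n.factorial : ℝ) * t ^ n * Real.exp (|x| / t) := by
  calc |pade x t n|
      ≤ ∑ p ∈ antidiagonal n, ((2 * n).factorial / n.factorial : ℝ) * t ^ n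
          * ((|x| / t) ^ p.2 / p.2.factorial) := by
        refine (abs_sum_le_sum_abs _ _).trans (sum_le_sum fun p hp => ?_)
        have hn := mem_antidiagonal.mp hp
        have h := padeCoeff_le p.1 p.2
        rw [hn] at h
        rw [abs_mul, abs_mul, abs_pow, abs_pow, abs_of_pos ht, Nat.abs_cast]
        calc (padeCoeff p.1 p.2 : ℝ) * t ^ p.1 * |x| ^ p.2
            ≤ ((2 * n).factorial / n.factorial : ℝ) / p.2.factorial * t ^ p.1 * |x| ^ p.2 := by
              gcongr
          _ = _ := by
              rw [← hn, pow_add, div_pow]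
              field_simp
    _ = ((2 * n).factorial / n.factorial : ℝ) * t ^ n
          * ∑ k ∈ range (n + 1), (|x| / t) ^ k / k.factorial := by
        rw [← mul_sum, ← Finset.Nat.sum_antidiagonal_swap,
          Finset.Nat.sum_antidiagonal_eq_sum_range_succ_mk]
        rfl
    _ ≤ _ := by
        gcongr
        exact Real.sum_le_exp_of_nonneg (by positivity) _

/-! ### The common factor of the coefficients -/

/-- The part of `n!` composed of the primes dividing `a`. It divides all the coefficients of the
Padé polynomials at `±a`. -/
def factorialPart (a n : ℕ) : ℕ := ∏ p ∈ a.primeFactors, p ^ n.factorial.factorization p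

/-- The primes of `a` lost in the quotient `(m + k)! / k!` are recovered from `a ^ k`. -/
lemma factorialPart_dvd (a m k : ℕ) : factorialPart a (m + k) ∣ padeCoeff m k * a ^ k := by
  rcases eq_or_ne a 0 with rfl | ha
  · simp [factorialPart]
  refine dvd_trans ?_ (mul_dvd_mul_right (dvd_mul_left _ ((2 * m + k).choose m)) (a ^ k))
  have hd : (m + k).descFactorial m ≠ 0 := (Nat.descFactorial_pos.mpr (by omega)).ne'
  refine Finset.prod_dvd_of_isRelPrime ?_ fun p hp => ?_
  · intro p hp q hq hpq
    exact Nat.coprime_iff_isRelPrime.mp (Nat.coprime_pow_primes _ _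
      (Nat.prime_of_mem_primeFactors hp) (Nat.prime_of_mem_primeFactors hq) hpq)
  · have hpp := Nat.prime_of_mem_primeFactors hp
    rw [hpp.pow_dvd_iff_le_factorization (mul_ne_zero hd (pow_ne_zero _ ha))]
    have h2 := Nat.factorial_mul_descFactorial (n := m + k) (k := m) (by omega)
    rw [show m + k - m = k by omega] at h2
    rw [← h2, Nat.factorization_mul (Nat.factorial_ne_zero _) hd,
      Nat.factorization_mul hd (pow_ne_zero _ ha), Nat.factorization_pow]
    simp only [Finsupp.add_apply, Finsupp.smul_apply, smul_eq_mul]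
    have h3 := (Nat.factorization_factorial_le_div_pred hpp k).trans (Nat.div_le_self _ _)
    have h4 : 1 ≤ a.factorization p :=
      hpp.factorization_pos_of_dvd ha (Nat.dvd_of_mem_primeFactors hp)
    nlinarith

lemma pade_eq_factorialPart_mul (s : ℤ) (t n : ℕ) :
    ∃ q : ℤ, pade s t n = factorialPart s.natAbs n * q := by
  have h : (factorialPart s.natAbs n : ℤ) ∣
      ∑ p ∈ antidiagonal n, (padeCoeff p.1 p.2 : ℤ) * t ^ p.1 * s ^ p.2 := by
    refine dvd_sum fun p hp => ?_
    have h1 := factorialPart_dvd s.natAbs p.1 p.2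
    rw [mem_antidiagonal.mp hp] at h1
    have h2 : (factorialPart s.natAbs n : ℤ) ∣ padeCoeff p.1 p.2 * s ^ p.2 := by
      rw [← Int.natAbs_dvd_natAbs]
      simpa [Int.natAbs_mul, Int.natAbs_pow] using h1
    rw [mul_right_comm]
    exact h2.mul_right _
  obtain ⟨q, hq⟩ := h
  refine ⟨q, ?_⟩
  have := congrArg (fun z : ℤ => (z : ℝ)) hq
  push_cast at this
  exact this

lemma rpow_pow_le {p : ℕ} (hp : p.Prime) (n : ℕ) :
    ((p : ℝ) ^ (1 / ((p : ℝ) - 1))) ^ n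
      ≤ p ^ n.factorial.factorization p * (p * (n + 1)) := by
  have hp1 : (1 : ℝ) < p := by exact_mod_cast hp.one_lt
  have : Fact p.Prime := ⟨hp⟩
  -- Legendre's formula, with a digit sum of at most `(p - 1) * (number of digits)`.
  have h1 := sub_one_mul_padicValNat_factorial (p := p) n
  have h2 : (p.digits n).sum ≤ (p.digits n).length * (p - 1) := by
    simpa using List.sum_le_card_nsmul (p.digits n) (p - 1)
      fun x hx => Nat.le_sub_one_of_lt (Nat.digits_lt_base hp.one_lt hx)
  have h3 : n ≤ (p - 1) * (n.factorial.factorization p + (p.digits n).length) := by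
    rw [Nat.factorization_def _ hp, mul_add, h1, mul_comm (p - 1)]
    omega
  have h4 : p ^ (p.digits n).length ≤ p * (n + 1) := by
    rcases eq_or_ne n 0 with rfl | hn
    · simpa using hp.one_le
    · exact (Nat.base_pow_length_digits_le p n hp.one_lt hn).trans (by gcongr; omega)
  have h5 : 1 / ((p : ℝ) - 1) * n ≤ (n.factorial.factorization p + (p.digits n).length : ℕ) := by
    rw [one_div_mul_eq_div, div_le_iff₀ (by linarith), mul_comm]
    have : (n : ℝ) ≤ ((p - 1 : ℕ) : ℝ) * (n.factorial.factorization p + (p.digits n).length : ℕ) :=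
      by exact_mod_cast h3
    rwa [Nat.cast_sub hp.one_le, Nat.cast_one] at this
  rw [← Real.rpow_natCast, ← Real.rpow_mul (by positivity)]
  refine (Real.rpow_le_rpow_of_exponent_le hp1.le h5).trans ?_
  rw [Real.rpow_natCast, pow_add]
  gcongr
  exact_mod_cast h4

lemma one_le_alpha (s : ℤ) : 1 ≤ alpha s := by
  refine one_le_prod fun p hp => ?_
  have hp1 : (1 : ℝ) < p := by exact_mod_cast (Nat.prime_of_mem_primeFactors hp).one_lt
  exact Real.one_le_rpow hp1.le (by have : 0 < (p : ℝ) - 1 := by linarith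
                                    positivity)

lemma prod_primeFactors_le {a : ℕ} (ha : a ≠ 0) : (∏ p ∈ a.primeFactors, (p : ℝ)) ≤ a := by
  have := Nat.le_of_dvd (Nat.pos_of_ne_zero ha) (Nat.prod_primeFactors_dvd a)
  rw [← Nat.cast_prod]
  exact_mod_cast this

lemma alpha_pow_le (s : ℤ) (hs : s ≠ 0) (n : ℕ) :
    alpha s ^ n ≤ factorialPart s.natAbs n
      * (s.natAbs * (n + 1) ^ s.natAbs.primeFactors.card) := by
  rw [alpha, ← prod_pow]
  calc ∏ p ∈ s.natAbs.primeFactors, ((p : ℝ) ^ (1 / ((p : ℝ) - 1))) ^ n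
      ≤ ∏ p ∈ s.natAbs.primeFactors,
          ((p : ℝ) ^ n.factorial.factorization p * (p * (n + 1))) :=
        prod_le_prod (fun _ _ => by positivity)
          fun p hp => rpow_pow_le (Nat.prime_of_mem_primeFactors hp) n
    _ = factorialPart s.natAbs n * ((∏ p ∈ s.natAbs.primeFactors, (p : ℝ))
          * (n + 1) ^ s.natAbs.primeFactors.card) := by
        rw [prod_mul_distrib, prod_mul_distrib, prod_const, factorialPart]
        push_cast
        rfl
    _ ≤ _ := by
        gcongr
        exact prod_primeFactors_le (by simpa using hs)

lemma alpha_lt (s : ℤ) (hs : 3 ≤ |s|) : alpha s < |(s : ℝ)| := by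
  have ha : (s.natAbs : ℝ) = |(s : ℝ)| := by simp
  have ha3 : 3 ≤ s.natAbs := by rw [Int.abs_eq_natAbs] at hs; exact_mod_cast hs
  have hle : ∀ p ∈ s.natAbs.primeFactors, (p : ℝ) ^ (1 / ((p : ℝ) - 1)) ≤ p := by
    intro p hp
    have hp2 : (2 : ℝ) ≤ p := by exact_mod_cast (Nat.prime_of_mem_primeFactors hp).two_le
    calc (p : ℝ) ^ (1 / ((p : ℝ) - 1)) ≤ (p : ℝ) ^ (1 : ℝ) :=
          Real.rpow_le_rpow_of_exponent_le (by linarith)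
            (by rw [div_le_one (by linarith)]; linarith)
      _ = p := Real.rpow_one _
  rw [← ha]
  by_cases h : ∃ p ∈ s.natAbs.primeFactors, 2 < p
  · obtain ⟨p, hp, hp2⟩ := h
    refine lt_of_lt_of_le (prod_lt_prod ?_ hle ⟨p, hp, ?_⟩) (prod_primeFactors_le (by omega))
    · intro q hq
      have : (0 : ℝ) < q := by exact_mod_cast (Nat.prime_of_mem_primeFactors hq).pos
      positivity
    · have hp2' : (2 : ℝ) < p := by exact_mod_cast hp2
      calc (p : ℝ) ^ (1 / ((p : ℝ) - 1)) < (p : ℝ) ^ (1 : ℝ) :=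
            Real.rpow_lt_rpow_of_exponent_lt (by linarith)
              (by rw [div_lt_one (by linarith)]; linarith)
        _ = p := Real.rpow_one _
  · have hsub : s.natAbs.primeFactors ⊆ {2} := by
      intro p hp
      have := (Nat.prime_of_mem_primeFactors hp).two_le
      have : ¬ 2 < p := fun h2 => h ⟨p, hp, h2⟩
      simp
      omega
    have h3 : (3 : ℝ) ≤ s.natAbs := by exact_mod_cast ha3
    rcases subset_singleton_iff.mp hsub with h0 | h0 <;> rw [alpha, h0] <;> norm_num <;>
      norm_num at h3 <;> linarith

/-! ### A lower bound in terms of the order of approximation -/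

/-- The growth factor `(2n)! / n!` of the Padé denominators. -/
noncomputable def centralFactor (n : ℕ) : ℝ := (2 * n).factorial / n.factorial

lemma centralFactor_pos (n : ℕ) : 0 < centralFactor n := by unfold centralFactor; positivity

lemma centralFactor_succ_le (n : ℕ) : centralFactor (n + 1) ≤ 4 * (n + 1) * centralFactor n := by
  have h : centralFactor (n + 1) = (4 * n + 2) * centralFactor n := by
    simp only [centralFactor, show 2 * (n + 1) = 2 * n + 1 + 1 by ring, Nat.factorial_succ]
    push_cast
    field_simp
    ring
  rw [h]
  exact mul_le_mul_of_nonneg_right (by linarith) (centralFactor_pos n).le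

lemma pow_le_centralFactor (n : ℕ) : (n : ℝ) ^ n ≤ centralFactor n := by
  rw [centralFactor, le_div_iff₀ (by positivity), mul_comm]
  have h := Nat.factorial_mul_pow_sub_le_factorial (n := n) (m := 2 * n) (by omega)
  rw [show 2 * n - n = n by omega] at h
  exact_mod_cast h

/-- Upper bound for the reduced Padé denominators. -/
noncomputable def denBound (s : ℤ) (t n : ℕ) : ℝ :=
  |(s : ℝ)| ^ 2 * Real.exp (|(s : ℝ)| / t) * (n + 1) ^ s.natAbs.primeFactors.card
    * (t / alpha s) ^ n * centralFactor n

/-- Upper bound for the reduced Padé remainders. -/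
noncomputable def remBound (s : ℤ) (t n : ℕ) : ℝ :=
  |(s : ℝ)| ^ 2 * Real.exp (|(s : ℝ)| / t) * (n + 1) ^ s.natAbs.primeFactors.card
    * (|(s : ℝ)| ^ 2 / (t * alpha s)) ^ n / centralFactor n

variable {s : ℤ} {t : ℕ}

lemma denBound_pos (hs : s ≠ 0) (ht : 1 ≤ t) (n : ℕ) : 0 < denBound s t n := by
  have := centralFactor_pos n
  have := one_le_alpha s
  have : (0 : ℝ) < |(s : ℝ)| := by simpa using hs
  have : (0 : ℝ) < t := by exact_mod_cast ht
  unfold denBound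
  positivity

lemma denBound_mul_remBound (ht : 1 ≤ t) (n : ℕ) :
    denBound s t n * remBound s t n = (|(s : ℝ)| ^ 2 * Real.exp (|(s : ℝ)| / t)) ^ 2
      * (n + 1) ^ (2 * s.natAbs.primeFactors.card) * (|(s : ℝ)| / alpha s) ^ (2 * n) := by
  have h1 := (centralFactor_pos n).ne'
  have h2 : alpha s ≠ 0 := (zero_lt_one.trans_le (one_le_alpha s)).ne'
  have h3 : (t : ℝ) ≠ 0 := by positivity
  have h4 : (|(s : ℝ)| / alpha s) ^ 2 = t / alpha s * (|(s : ℝ)| ^ 2 / (t * alpha s)) := by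
    field_simp
  rw [pow_mul (|(s : ℝ)| / alpha s), h4, mul_pow (_ / _), denBound, remBound]
  field_simp
  ring

/-- Dividing a quantity by the common factor `factorialPart` gains `alpha s ^ n`, up to a polynomial
in `n`. -/
lemma abs_le_of_factorialPart_mul (hs : s ≠ 0) {n : ℕ} {u v : ℝ}
    (h : |factorialPart s.natAbs n * u| ≤ v) :
    |u| ≤ |(s : ℝ)| * (n + 1) ^ s.natAbs.primeFactors.card * v / alpha s ^ n := by
  have ha := alpha_pow_le s hs n
  rw [Nat.cast_natAbs, Int.cast_abs] at ha
  have h0 : 0 < alpha s := zero_lt_one.trans_le (one_le_alpha s)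
  rw [abs_mul, Nat.abs_cast] at h
  rw [le_div_iff₀ (by positivity)]
  calc |u| * alpha s ^ n
      ≤ |u| * (factorialPart s.natAbs n
        * (|(s : ℝ)| * (n + 1) ^ s.natAbs.primeFactors.card)) := by gcongr
    _ = |(s : ℝ)| * (n + 1) ^ s.natAbs.primeFactors.card * (factorialPart s.natAbs n * |u|) := by
        ring
    _ ≤ _ := by gcongr

/-- The integer linear forms `q n * exp (s / t) - p n` given by the Padé approximants after
division by the common factor of their coefficients. -/
lemma exists_linear_forms (hs : s ≠ 0) (ht : 1 ≤ t) :
    ∃ p q : ℕ → ℤ, (∀ n, |(q n : ℝ)| ≤ denBound s t n) ∧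
      (∀ n, |q n * Real.exp ((s : ℝ) / t) - p n| ≤ remBound s t n) ∧
      ∀ n, q n * p (n + 1) - q (n + 1) * p n ≠ 0 := by
  choose p hp using fun n => pade_eq_factorialPart_mul s t n
  choose q hq using fun n => pade_eq_factorialPart_mul (-s) t n
  simp only [Int.natAbs_neg, Int.cast_neg] at hq
  have ht1 : (1 : ℝ) ≤ t := by exact_mod_cast ht
  have ht0 : (0 : ℝ) < t := by linarith
  have hs1 : (1 : ℝ) ≤ |(s : ℝ)| := by exact_mod_cast Int.one_le_abs hs
  have hα : 0 < alpha s := zero_lt_one.trans_le (one_le_alpha s)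
  refine ⟨p, q, fun n => ?_, fun n => ?_, fun n h => ?_⟩
  · have h1 := abs_pade_le (-(s : ℝ)) t ht0 n
    rw [hq, abs_neg] at h1
    refine (abs_le_of_factorialPart_mul hs h1).trans ?_
    have hf := centralFactor_pos n
    calc |(s : ℝ)| * (n + 1) ^ s.natAbs.primeFactors.card
          * (centralFactor n * t ^ n * Real.exp (|(s : ℝ)| / t)) / alpha s ^ n
        = |(s : ℝ)| ^ 1 * Real.exp (|(s : ℝ)| / t) * (n + 1) ^ s.natAbs.primeFactors.card
          * (t / alpha s) ^ n * centralFactor n := by rw [div_pow, pow_one]; ring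
      _ ≤ denBound s t n := by
          unfold denBound
          gcongr
          norm_num
  · have h1 := pade_remainder t ((s : ℝ) / t) n
    rw [mul_div_cancel₀ _ ht0.ne', hp, hq] at h1
    have h2 : |factorialPart s.natAbs n * (q n * Real.exp ((s : ℝ) / t) - p n)|
        ≤ (|(s : ℝ)| ^ 2 / t) ^ n * |(s : ℝ)| * Real.exp (|(s : ℝ)| / t) / centralFactor n := by
      rw [show (factorialPart s.natAbs n : ℝ) * (q n * Real.exp ((s : ℝ) / t) - p n)
        = factorialPart s.natAbs n * q n * Real.exp ((s : ℝ) / t)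
          - factorialPart s.natAbs n * p n by ring, h1, abs_mul, abs_mul, abs_mul, abs_pow,
        abs_neg, abs_one, one_pow, one_mul, abs_pow, abs_pow, abs_div, abs_of_pos ht0]
      have h3 := abs_remSeries_le n ((s : ℝ) / t)
      rw [abs_div, abs_of_pos ht0] at h3
      have h4 : (n.factorial / (2 * n + 1).factorial : ℝ) ≤ 1 / centralFactor n := by
        rw [centralFactor, one_div_div]
        gcongr
        omega
      have h5 : (t : ℝ) ^ n * (|(s : ℝ)| / t) ^ (2 * n + 1)
          = (|(s : ℝ)| ^ 2 / t) ^ n * (|(s : ℝ)| / t) := by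
        rw [pow_succ, pow_mul, ← mul_assoc, ← mul_pow]
        congr 2
        field_simp
      rw [h5]
      calc (|(s : ℝ)| ^ 2 / t) ^ n * (|(s : ℝ)| / t) * |remSeries n ((s : ℝ) / t)|
          ≤ (|(s : ℝ)| ^ 2 / t) ^ n * |(s : ℝ)|
            * (1 / centralFactor n * Real.exp (|(s : ℝ)| / t)) := by
            gcongr
            · exact div_le_self (abs_nonneg _) ht1
            · exact h3.trans (by gcongr)
        _ = _ := by ring
    refine (abs_le_of_factorialPart_mul hs h2).trans (le_of_eq ?_)
    rw [remBound, ← div_div (|(s : ℝ)| ^ 2), div_pow _ (alpha s)]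
    ring
  · have h1 := pade_det (s : ℝ) t n
    rw [hp, hp, hq, hq] at h1
    have h2 : (q n : ℝ) * p (n + 1) - q (n + 1) * p n = 0 := by exact_mod_cast h
    have h3 : (-1 : ℝ) ^ n * 2 * (s : ℝ) ^ (2 * n + 1) = 0 := by
      rw [← h1]
      linear_combination
        (factorialPart s.natAbs n : ℝ) * factorialPart s.natAbs (n + 1) * h2
    have hs' : (s : ℝ) ≠ 0 := by exact_mod_cast hs
    have : (-1 : ℝ) ^ n * 2 * (s : ℝ) ^ (2 * n + 1) ≠ 0 := by
      have : (-1 : ℝ) ^ n ≠ 0 := pow_ne_zero _ (by norm_num)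
      positivity
    exact this h3

/-- One of two consecutive linear forms separates `exp (s / t)` from a given fraction. -/
lemma exists_one_le_abs_sub_mul (hs : s ≠ 0) (ht : 1 ≤ t) {N : ℕ} (hN : 1 ≤ N) (M : ℤ) {n : ℕ}
    (h0 : 2 * N * remBound s t n < 1) (h1 : 2 * N * remBound s t (n + 1) < 1) :
    1 ≤ |Real.exp ((s : ℝ) / t) - M / N| * (2 * N * denBound s t n) ∨
      1 ≤ |Real.exp ((s : ℝ) / t) - M / N| * (2 * N * denBound s t (n + 1)) := by
  obtain ⟨p, q, hq, hr, hdet⟩ := exists_linear_forms hs ht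
  have hN0 : (0 : ℝ) < N := by exact_mod_cast hN
  have key : ∀ k, 2 * N * remBound s t k < 1 → (N : ℤ) * p k - M * q k ≠ 0 →
      1 ≤ |Real.exp ((s : ℝ) / t) - M / N| * (2 * N * denBound s t k) := by
    intro k hk hne
    have h2 : (1 : ℝ) ≤ |(N : ℝ) * p k - M * q k| := by exact_mod_cast Int.one_le_abs hne
    have h3 : (N : ℝ) * p k - M * q k = -(N * (q k * Real.exp ((s : ℝ) / t) - p k))
        + q k * (N * (Real.exp ((s : ℝ) / t) - M / N)) := by
      field_simp
      ring
    have h4 : |(N : ℝ) * p k - M * q k| ≤ N * remBound s t k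
        + denBound s t k * (N * |Real.exp ((s : ℝ) / t) - M / N|) := by
      rw [h3]
      refine (abs_add_le _ _).trans ?_
      rw [abs_neg, abs_mul, abs_mul, abs_mul (N : ℝ), Nat.abs_cast]
      have := hq k
      have := hr k
      gcongr
    linarith
  by_cases hz : (N : ℤ) * p n - M * q n = 0
  · refine Or.inr (key _ h1 fun hz' => ?_)
    have : (N : ℤ) * (q n * p (n + 1) - q (n + 1) * p n) = 0 := by
      linear_combination q n * hz' - q (n + 1) * hz
    rcases mul_eq_zero.mp this with h | h
    · omega
    · exact hdet n h
  · exact Or.inl (key _ h0 hz)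

lemma denBound_succ_le (hs : s ≠ 0) (ht : 1 ≤ t) (n : ℕ) :
    denBound s t (n + 1)
      ≤ 2 ^ s.natAbs.primeFactors.card * (4 * t) * (n + 1) * denBound s t n := by
  have h1 := centralFactor_succ_le n
  have h2 := centralFactor_pos n
  have h3 := centralFactor_pos (n + 1)
  have hα := one_le_alpha s
  have ht0 : (0 : ℝ) < t := by exact_mod_cast ht
  set w := s.natAbs.primeFactors.card
  set C := |(s : ℝ)| ^ 2 * Real.exp (|(s : ℝ)| / t)
  calc denBound s t (n + 1)
      = C * ((n + 1 : ℕ) + 1 : ℝ) ^ w * ((t / alpha s) ^ n * (t / alpha s))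
        * centralFactor (n + 1) := by rw [denBound, pow_succ (_ / alpha s)]
    _ ≤ C * (2 * (n + 1) : ℝ) ^ w * ((t / alpha s) ^ n * t)
        * (4 * (n + 1) * centralFactor n) := by
        gcongr
        · push_cast
          linarith
        · exact div_le_self ht0.le hα
    _ = _ := by
        rw [denBound, mul_pow]
        ring

lemma add_one_pow_le (n w : ℕ) : ((n : ℝ) + 1) ^ w ≤ Real.exp w ^ n := by
  rw [← Real.exp_nat_mul, mul_comm, Real.exp_nat_mul]
  gcongr
  exact Real.add_one_le_exp _

lemma remBound_le (hs : s ≠ 0) (n : ℕ) :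
    remBound s t n ≤ |(s : ℝ)| ^ 2 * Real.exp (|(s : ℝ)| / t)
      * (Real.exp s.natAbs.primeFactors.card * (|(s : ℝ)| ^ 2 / (t * alpha s))) ^ n
        / centralFactor n := by
  have hα := one_le_alpha s
  have hf := centralFactor_pos n
  rw [remBound, mul_pow, ← mul_assoc]
  gcongr
  exact add_one_pow_le n _

lemma tendsto_remBound (hs : s ≠ 0) : Tendsto (remBound s t) atTop (𝓝 0) := by
  have hα := one_le_alpha s
  have hlim := (FloorSemiring.tendsto_pow_div_factorial_atTop
    (Real.exp s.natAbs.primeFactors.card * (|(s : ℝ)| ^ 2 / (t * alpha s)))).const_mul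
    (|(s : ℝ)| ^ 2 * Real.exp (|(s : ℝ)| / t))
  rw [mul_zero] at hlim
  refine squeeze_zero (fun n => ?_) (fun n => (remBound_le hs n).trans ?_) hlim
  · have := centralFactor_pos n
    unfold remBound
    positivity
  · rw [mul_div_assoc]
    gcongr
    rw [centralFactor, le_div_iff₀ (by positivity)]
    exact_mod_cast Nat.factorial_mul_factorial_dvd_factorial_add n n |>.trans
      (by rw [two_mul]) |> Nat.le_of_dvd (Nat.factorial_pos _)

/-- The order `m` of approximation is the last one whose remainder bound is at least `1 / (2N)`. -/
lemma exists_last_index (hs : s ≠ 0) {N : ℕ} (hN : 1 ≤ N) :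
    ∃ m, 1 ≤ 2 * N * remBound s t m ∧ ∀ k, m < k → 2 * N * remBound s t k < 1 := by
  classical
  have hN1 : (1 : ℝ) ≤ N := by exact_mod_cast hN
  have hex : ∃ n, ∀ k, n ≤ k → 2 * N * remBound s t k < 1 := by
    have h := (tendsto_remBound (t := t) hs).const_mul (2 * (N : ℝ))
    rw [mul_zero] at h
    exact eventually_atTop.mp (h.eventually (gt_mem_nhds zero_lt_one))
  have h0 : 1 ≤ 2 * N * remBound s t 0 := by
    have hs1 : (1 : ℝ) ≤ |(s : ℝ)| := by exact_mod_cast Int.one_le_abs hs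
    have h1 : 1 ≤ Real.exp (|(s : ℝ)| / t) := Real.one_le_exp (by positivity)
    have h2 : 1 ≤ |(s : ℝ)| ^ 2 * Real.exp (|(s : ℝ)| / t) :=
      one_le_mul_of_one_le_of_one_le (one_le_pow₀ hs1) h1
    have h3 : remBound s t 0 = |(s : ℝ)| ^ 2 * Real.exp (|(s : ℝ)| / t) := by
      simp [remBound, centralFactor]
    rw [h3]
    nlinarith
  obtain ⟨m, hm⟩ : ∃ m, Nat.find hex = m + 1 := by
    refine Nat.exists_eq_succ_of_ne_zero fun h => ?_
    exact absurd (Nat.find_spec hex 0 h.le) (not_lt.mpr h0)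
  have hlast : ∀ k, m < k → 2 * N * remBound s t k < 1 :=
    fun k hk => Nat.find_spec hex k (by omega)
  refine ⟨m, ?_, hlast⟩
  by_contra! hcon
  refine Nat.find_min hex (m := m) (by omega) fun k hk => ?_
  rcases hk.eq_or_lt with rfl | hk
  · exact hcon
  · exact hlast k hk

/-- Every fraction with denominator `N` stays away from `exp (s / t)` by an amount governed by an
order of approximation `m` with `m log m ≤ log N + O(m)`. -/
lemma exists_order_lower_bound (hs : s ≠ 0) (ht : 1 ≤ t) :
    ∃ A K : ℝ, 0 < A ∧ 0 < K ∧ ∃ W : ℕ, ∀ N : ℕ, 1 ≤ N → ∀ M : ℤ, ∃ m : ℕ,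
      m * Real.log m ≤ Real.log N + A * (m + 1) ∧
      1 ≤ |Real.exp ((s : ℝ) / t) - M / N|
        * ((N : ℝ) ^ 2 * (K * (m + 1) ^ W * (|(s : ℝ)| / alpha s) ^ (2 * m))) := by
  have hα := one_le_alpha s
  have hs1 : (1 : ℝ) ≤ |(s : ℝ)| := by exact_mod_cast Int.one_le_abs hs
  have ht1 : (1 : ℝ) ≤ t := by exact_mod_cast ht
  set w := s.natAbs.primeFactors.card with hw
  set C := |(s : ℝ)| ^ 2 * Real.exp (|(s : ℝ)| / t) with hC
  set r := |(s : ℝ)| ^ 2 / (t * alpha s) with hr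
  set H : ℝ := 2 ^ w * (4 * t) with hH
  have hC1 : 1 ≤ C := one_le_mul_of_one_le_of_one_le (one_le_pow₀ hs1)
    (Real.one_le_exp (by positivity))
  have hr0 : 0 < r := by positivity
  have hH1 : 1 ≤ H := one_le_mul_of_one_le_of_one_le (one_le_pow₀ (by norm_num)) (by linarith)
  refine ⟨Real.log (2 * C) + w + |Real.log r|, 2 * (2 * H ^ 2) * 2 * C ^ 2, ?_, by positivity,
    2 + 2 * w, fun N hN M => ?_⟩
  · have : 0 < Real.log (2 * C) := Real.log_pos (by linarith)
    positivity
  have hN0 : (0 : ℝ) < N := by exact_mod_cast hN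
  obtain ⟨m, hm, hlast⟩ := exists_last_index (t := t) hs hN
  refine ⟨m, ?_, ?_⟩
  · have hf := pow_le_centralFactor m
    have hf0 := centralFactor_pos m
    have h1 : centralFactor m ≤ 2 * C * N * (Real.exp w * r) ^ m := by
      have h2 := remBound_le (t := t) hs m
      rw [← hC, ← hw, ← hr] at h2
      have h3 : 1 ≤ 2 * N * (C * (Real.exp w * r) ^ m / centralFactor m) :=
        hm.trans (by gcongr)
      rw [← mul_div_assoc, le_div_iff₀ hf0, one_mul] at h3
      linarith
    rcases Nat.eq_zero_or_pos m with rfl | hm0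
    · have : 0 ≤ Real.log N := Real.log_natCast_nonneg N
      have : 0 < Real.log (2 * C) := Real.log_pos (by linarith)
      simp
      positivity
    have h4 := Real.log_le_log (by positivity) (hf.trans h1)
    rw [Real.log_mul (by positivity) (by positivity), Real.log_mul (by positivity) (by positivity),
      Real.log_pow, Real.log_pow, Real.log_mul (Real.exp_pos _).ne' hr0.ne', Real.log_exp] at h4
    have h5 : 0 ≤ Real.log (2 * C) := Real.log_nonneg (by linarith)
    have h6 : (m : ℝ) * Real.log r ≤ m * |Real.log r| := by gcongr; exact le_abs_self _
    have h7 := mul_nonneg (Nat.cast_nonneg (α := ℝ) m) h5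
    have h8 := abs_nonneg (Real.log r)
    have h9 : (0 : ℝ) ≤ w := Nat.cast_nonneg w
    linarith
  · set B := denBound s t m with hB
    have hB0 : 0 < B := denBound_pos hs ht m
    have hm1 : (0 : ℝ) ≤ m := Nat.cast_nonneg m
    have hB1 : 0 < denBound s t (m + 1) := denBound_pos hs ht (m + 1)
    have hd1 : denBound s t (m + 1) ≤ H * (m + 1) * B := denBound_succ_le hs ht m
    have hd2 : denBound s t (m + 1 + 1) ≤ 2 * H ^ 2 * (m + 1) ^ 2 * B := by
      refine (denBound_succ_le hs ht (m + 1)).trans ?_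
      push_cast
      calc H * (m + 1 + 1) * denBound s t (m + 1)
          ≤ H * (2 * (m + 1)) * (H * (m + 1) * B) := by
            gcongr
            linarith
        _ = _ := by ring
    have hd1' : denBound s t (m + 1) ≤ 2 * H ^ 2 * (m + 1) ^ 2 * B := by
      refine hd1.trans ?_
      gcongr ?_ * B
      have h1 : H ≤ 2 * H ^ 2 := by nlinarith
      have h2 : (m : ℝ) + 1 ≤ (m + 1) ^ 2 := by nlinarith
      gcongr
    have hmain : 1 ≤ |Real.exp ((s : ℝ) / t) - M / N|
        * (2 * N * (2 * H ^ 2 * (m + 1) ^ 2 * B)) := by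
      rcases exists_one_le_abs_sub_mul hs ht hN M (hlast (m + 1) (by omega))
        (hlast (m + 1 + 1) (by omega)) with h | h
      · exact h.trans (by gcongr)
      · exact h.trans (by gcongr)
    -- Multiplying by `1 ≤ 2 * N * remBound s t m` turns `B` into the product of the two bounds.
    have hprod := one_le_mul_of_one_le_of_one_le hmain hm
    have hBb : B * remBound s t m = C ^ 2 * (m + 1) ^ (2 * w) * (|(s : ℝ)| / alpha s) ^ (2 * m) :=
      denBound_mul_remBound ht m
    refine hprod.trans (le_of_eq ?_)
    calc _ = |Real.exp ((s : ℝ) / t) - M / N| * ((N : ℝ) ^ 2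
          * (2 * (2 * H ^ 2) * 2 * (m + 1) ^ 2 * (B * remBound s t m))) := by ring
      _ = _ := by rw [hBb, pow_add]; ring

/-! ### Inverting `x log x` -/

lemma eventually_log_le (c : ℝ) (hc : 0 < c) : ∀ᶠ L : ℝ in atTop, Real.log L ≤ c * L := by
  filter_upwards [Real.isLittleO_log_id_atTop.bound hc, eventually_ge_atTop 0] with L h h0
  rw [id, Real.norm_eq_abs, Real.norm_eq_abs, abs_of_nonneg h0] at h
  exact (le_abs_self _).trans h

/-- The main term of the exponent, with `L = log log N`. -/
noncomputable def mainTerm (C L : ℝ) : ℝ := 1 / (L - Real.log L) + C / L ^ 2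

/-- If `x log x ≤ y + O(x)`, then `x ≤ y / (log y - log log y) + O(y / (log y) ^ 2)`. -/
lemma le_of_mul_log_le (A : ℝ) (hA : 0 < A) :
    ∀ᶠ L : ℝ in atTop, ∀ x : ℝ, 0 ≤ x → x * Real.log x ≤ Real.exp L + A * (x + 1) →
      x ≤ mainTerm (6 * A) L * Real.exp L := by
  filter_upwards [eventually_log_le (1 / 4) (by norm_num), eventually_ge_atTop 1,
    eventually_ge_atTop (4 * A), (Real.tendsto_exp_div_pow_atTop 1).eventually_gt_atTop 1]
    with L hl hL1 hLA hexp x hx0 hx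
  have hL0 : 0 < L := by linarith
  have hlog : 0 ≤ Real.log L := Real.log_nonneg hL1
  have hy := Real.exp_pos L
  by_contra! hlt
  set y := Real.exp L with hyL
  set X := mainTerm (6 * A) L * y with hX
  have hXy : y / L ≤ X := by
    have h1 : 1 / L ≤ 1 / (L - Real.log L) :=
      one_div_le_one_div_of_le (by linarith) (by linarith)
    have h2 : 0 ≤ 6 * A / L ^ 2 := by positivity
    calc y / L = 1 / L * y := by ring
      _ ≤ X := by rw [hX, mainTerm]; gcongr; linarith
  have hX0 : 0 < X := lt_of_lt_of_le (by positivity) hXy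
  have hlogX : L - Real.log L ≤ Real.log X := by
    have := Real.log_le_log (by positivity) hXy
    rwa [Real.log_div hy.ne' hL0.ne', hyL, Real.log_exp] at this
  have hlogx : Real.log X ≤ Real.log x := Real.log_le_log hX0 hlt.le
  have h1 : X * (L - Real.log L - A) ≤ x * (Real.log x - A) :=
    mul_le_mul hlt.le (by linarith) (by linarith) hx0
  have h2 : y + A * (y / L) ≤ X * (L - Real.log L - A) := by
    set D := L - Real.log L with hD
    have hD0 : 0 < D := by linarith
    have e : X * (D - A) = y - A * (y / D) + 6 * A * (y / L) * ((D - A) / L) := by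
      rw [hX, mainTerm, ← hD]
      field_simp
    have h3 : y / D ≤ 2 * (y / L) := by
      rw [← mul_div_assoc, div_le_div_iff₀ hD0 hL0]
      nlinarith
    have h4 : 1 / 2 ≤ (D - A) / L := by
      rw [le_div_iff₀ hL0]
      linarith
    have h5 : 0 < y / L := by positivity
    have h6 : 6 * A * (y / L) * (1 / 2) ≤ 6 * A * (y / L) * ((D - A) / L) := by gcongr
    have h7 : A * (y / D) ≤ A * (2 * (y / L)) := by gcongr
    rw [e]
    linarith
  have h3 : A * 1 < A * (y / L) := by
    rw [pow_one] at hexp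
    gcongr
  linarith

/-- Polynomial factors in the order of approximation are absorbed by the term `C / L ^ 2`. -/
lemma order_bound_lt (A K R : ℝ) (hA : 0 < A) (hK : 0 < K) (hR : 1 < R) (W : ℕ) :
    ∃ C : ℝ, 0 < C ∧ ∀ᶠ L : ℝ in atTop, ∀ m : ℕ,
      m * Real.log m ≤ Real.exp L + A * (m + 1) →
      K * (m + 1) ^ W * R ^ (2 * m) < Real.exp (2 * Real.log R * mainTerm C L * Real.exp L) := by
  have hlam : 0 < Real.log R := Real.log_pos hR
  refine ⟨6 * A + 1, by positivity, ?_⟩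
  filter_upwards [le_of_mul_log_le A hA, eventually_log_le (1 / 4) (by norm_num),
    eventually_ge_atTop 4, eventually_ge_atTop (12 * A),
    (Real.tendsto_exp_div_pow_atTop 3).eventually_gt_atTop
      ((|Real.log K| + 2 * W) / (2 * Real.log R))] with L hm hl hL4 hLA hexp m h
  have hL0 : 0 < L := by linarith
  have hmX := hm m (Nat.cast_nonneg m) h
  have hy := Real.exp_pos L
  set y := Real.exp L with hyL
  have hone : mainTerm (6 * A) L ≤ 1 := by
    have h1 : 1 / (L - Real.log L) ≤ 1 / 2 :=
      one_div_le_one_div_of_le (by norm_num) (by linarith)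
    have h2 : 6 * A / L ^ 2 ≤ 1 / 2 := by
      rw [div_le_div_iff₀ (by positivity) (by norm_num)]
      nlinarith
    unfold mainTerm
    linarith
  have hmy : (m : ℝ) ≤ y := hmX.trans (by nlinarith)
  have hlogm : Real.log (m + 1) ≤ 2 * L := by
    have h1 : (m : ℝ) + 1 ≤ Real.exp (2 * L) := by
      have h2 : Real.exp (2 * L) = y * y := by rw [hyL, ← Real.exp_add]; ring_nf
      have h3 : L + 1 ≤ y := Real.add_one_le_exp L
      rw [h2]
      nlinarith
    have := Real.log_le_log (by positivity) h1
    rwa [Real.log_exp] at this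
  have hsmall : Real.log K + W * (2 * L) < 2 * Real.log R * (y / L ^ 2) := by
    rw [div_lt_iff₀ (by positivity)] at hexp
    have h1 : y / L ^ 2 = y / L ^ 3 * L := by field_simp
    rw [h1]
    have h2 : (|Real.log K| + 2 * W) * L < y / L ^ 3 * (2 * Real.log R) * L := by gcongr
    have h3 : Real.log K ≤ |Real.log K| * L := by
      nlinarith [le_abs_self (Real.log K), abs_nonneg (Real.log K)]
    linarith
  have hmain : mainTerm (6 * A + 1) L * y = mainTerm (6 * A) L * y + y / L ^ 2 := by
    unfold mainTerm
    ring
  rw [← Real.log_lt_iff_lt_exp (by positivity), Real.log_mul (by positivity) (by positivity),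
    Real.log_mul (by positivity) (by positivity), Real.log_pow, Real.log_pow, mul_assoc, hmain]
  push_cast
  have h1 : (W : ℝ) * Real.log (m + 1) ≤ W * (2 * L) := by gcongr
  have h2 : 2 * Real.log R * m ≤ 2 * Real.log R * (mainTerm (6 * A) L * y) := by gcongr
  linarith

/-! ### Comparison with the two exponents -/

lemma mainTerm_le_mul_eps (C δ : ℝ) (hδ : 0 < δ) :
    ∀ᶠ L : ℝ in atTop, mainTerm C L ≤ (1 + (1 + δ) * (Real.log L / L)) / L := by
  filter_upwards [eventually_log_le (1 / 2) (by norm_num),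
    eventually_log_le (δ / 4) (by positivity), eventually_ge_atTop 1,
    Real.tendsto_log_atTop.eventually_ge_atTop (2 * C / δ)] with L h2 h4 hL1 hC
  have hL0 : 0 < L := by linarith
  have hlog : 0 ≤ Real.log L := Real.log_nonneg hL1
  set l := Real.log L
  rw [div_le_iff₀ hδ] at hC
  have hD : 0 < L - l := by linarith
  -- `1 / (L - l) = 1 / L + l / (L (L - l))`, and `L / (L - l) ≤ 1 + δ / 2`.
  have h5 : L / (L - l) ≤ 1 + δ / 2 := by
    rw [div_le_iff₀ hD]
    nlinarith
  have h6 : l * (L / (L - l)) + C ≤ (1 + δ) * l := by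
    have : l * (L / (L - l)) ≤ l * (1 + δ / 2) := by gcongr
    linarith
  have e1 : mainTerm C L = 1 / L + (l * (L / (L - l)) + C) / L ^ 2 := by
    change 1 / (L - l) + C / L ^ 2 = _
    field_simp
    ring
  have e2 : (1 + (1 + δ) * (l / L)) / L = 1 / L + (1 + δ) * l / L ^ 2 := by field_simp
  rw [e1, e2]
  gcongr

lemma log_zIter_bounds (n : ℕ) :
    ∀ᶠ L : ℝ in atTop, L - Real.log L ≤ Real.log (zIter (n + 1) (Real.exp L)) ∧
      Real.log (zIter (n + 1) (Real.exp L)) ≤ L - Real.log L + 1 := by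
  -- It is enough that the logarithm of the previous iterate lies between `L / 2` and `L`.
  have step : ∀ k (L : ℝ), 1 ≤ L → L / 2 ≤ Real.log (zIter k (Real.exp L)) →
      Real.log (zIter k (Real.exp L)) ≤ L →
      L - Real.log L ≤ Real.log (zIter (k + 1) (Real.exp L)) ∧
      Real.log (zIter (k + 1) (Real.exp L)) ≤ L - Real.log L + 1 := by
    intro k L hL h1 h2
    have h0 : 0 < Real.log (zIter k (Real.exp L)) := by linarith
    rw [zIter, Real.log_div (Real.exp_pos L).ne' h0.ne', Real.log_exp]
    have h3 := Real.log_le_log h0 h2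
    have h4 := Real.log_le_log (by positivity) h1
    rw [Real.log_div (by positivity) (by norm_num)] at h4
    have h5 := Real.log_two_lt_d9
    constructor <;> linarith
  induction n with
  | zero =>
    filter_upwards [eventually_ge_atTop 1] with L hL
    exact step 0 L hL (by simp [zIter]; linarith) (by simp [zIter])
  | succ n ih =>
    filter_upwards [ih, eventually_log_le (1 / 2) (by norm_num),
      Real.tendsto_log_atTop.eventually_ge_atTop 1, eventually_ge_atTop 1] with L h hl hl1 hL
    exact step (n + 1) L hL (by linarith [h.1]) (by linarith [h.2])

lemma mainTerm_le_zIter (C : ℝ) (n : ℕ) :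
    ∀ᶠ L : ℝ in atTop,
      mainTerm C L ≤ 1 / Real.log (zIter (n + 1) (Real.exp L)) + (C + 4) / L ^ 2 := by
  filter_upwards [log_zIter_bounds n, eventually_log_le (1 / 2) (by norm_num),
    eventually_ge_atTop 1] with L h hl hL
  have hL0 : 0 < L := by linarith
  set D := L - Real.log L with hD
  have hD2 : L / 2 ≤ D := by linarith
  have hD0 : 0 < D := by linarith
  have h1 : 1 / (D + 1) ≤ 1 / Real.log (zIter (n + 1) (Real.exp L)) :=
    one_div_le_one_div_of_le (by linarith [h.1]) h.2
  have h2 : 1 / D ≤ 1 / (D + 1) + 4 / L ^ 2 := by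
    have e : 1 / D - 1 / (D + 1) = 1 / (D * (D + 1)) := by field_simp; ring
    have h3 : 1 / (D * (D + 1)) ≤ 4 / L ^ 2 := by
      rw [div_le_div_iff₀ (by positivity) (by positivity)]
      nlinarith
    linarith
  rw [mainTerm, ← hD, add_div]
  linarith

/-! ### The irrationality measure -/

lemma tendsto_log_log_natCast :
    Tendsto (fun N : ℕ => Real.log (Real.log N)) atTop atTop :=
  Real.tendsto_log_atTop.comp (Real.tendsto_log_atTop.comp tendsto_natCast_atTop_atTop)

lemma log_abs_div_alpha_pos {s : ℤ} (hs : 3 ≤ |s|) : 0 < Real.log (|(s : ℝ)| / alpha s) :=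
  Real.log_pos ((one_lt_div (zero_lt_one.trans_le (one_le_alpha s))).mpr (alpha_lt s hs))

/-- The lower bound with the exponent in closed form. Both exponents of the theorem exceed this
one for large `N`. -/
lemma exists_eventually_one_lt (s : ℤ) (t : ℕ) (hs : 3 ≤ |s|) (ht : 1 ≤ t) :
    ∃ C : ℝ, 0 < C ∧ ∀ᶠ N : ℕ in atTop, ∀ M : ℤ, ∀ E : ℝ,
      mainTerm C (Real.log (Real.log N)) ≤ E →
      1 < |Real.exp ((s : ℝ) / (t : ℝ)) - (M : ℝ) / (N : ℝ)| *
        (N : ℝ) ^ (2 + 2 * Real.log (|(s : ℝ)| / alpha s) * E) := by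
  have hs0 : s ≠ 0 := by
    rintro rfl
    simp at hs
  obtain ⟨A, K, hA, hK, W, horder⟩ := exists_order_lower_bound hs0 ht
  have hα := one_le_alpha s
  have hR : 1 < |(s : ℝ)| / alpha s := (one_lt_div (by linarith)).mpr (alpha_lt s hs)
  have hlam := log_abs_div_alpha_pos hs
  obtain ⟨C, hC, hlt⟩ := order_bound_lt A K _ hA hK hR W
  refine ⟨C, hC, ?_⟩
  filter_upwards [tendsto_log_log_natCast.eventually hlt, eventually_ge_atTop 2]
    with N hN hN2 M E hE
  obtain ⟨m, hm, h1⟩ := horder N (by omega) M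
  have hN1 : (1 : ℝ) < N := by exact_mod_cast hN2
  have hN0 : (0 : ℝ) < N := by linarith
  have hlog : 0 < Real.log N := Real.log_pos hN1
  rw [Real.exp_log hlog] at hN
  have hd : 0 < |Real.exp ((s : ℝ) / t) - M / N| := by
    refine (abs_nonneg _).lt_of_ne fun h => ?_
    rw [← h, zero_mul] at h1
    linarith
  refine h1.trans_lt (mul_lt_mul_of_pos_left ?_ hd)
  rw [Real.rpow_add hN0, Real.rpow_two]
  refine mul_lt_mul_of_pos_left ((hN m hm).trans_le ?_) (by positivity)
  rw [Real.rpow_def_of_pos hN0, Real.exp_le_exp, mul_comm (Real.log _)]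
  gcongr

end ExpApprox

theorem corollary3 (s : ℤ) (t : ℕ) (hs : 3 ≤ |s|) (ht : 1 ≤ t) (hst : Int.gcd s (t : ℤ) = 1) :
    (∀ ε₃ : ℝ, 0 < ε₃ →
      ∃ N₃ : ℕ, 1 ≤ N₃ ∧
        ∀ M : ℤ, M ≠ 0 → ∀ N : ℕ, N₃ ≤ N →
          1 < |Real.exp ((s : ℝ) / (t : ℝ)) - (M : ℝ) / (N : ℝ)| *
            (N : ℝ) ^ (2 + 2 * Real.log (|(s : ℝ)| / ExpApprox.alpha s) *
              (1 + (1 + ε₃) * ExpApprox.eps N) / Real.log (Real.log (N : ℝ)))) ∧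
    (∀ n : ℕ, 2 ≤ n →
      ∃ c₃ : ℝ, 0 < c₃ ∧ ∃ N₃ : ℕ, 1 ≤ N₃ ∧
        ∀ M : ℤ, M ≠ 0 → ∀ N : ℕ, N₃ ≤ N →
          1 < |Real.exp ((s : ℝ) / (t : ℝ)) - (M : ℝ) / (N : ℝ)| *
            (N : ℝ) ^ (2 + 2 * Real.log (|(s : ℝ)| / ExpApprox.alpha s) *
              (1 / Real.log (ExpApprox.zIter (n - 1) (Real.log (N : ℝ))) +
                c₃ / (Real.log (Real.log (N : ℝ))) ^ 2))) := by
  obtain ⟨C, hC, hmain⟩ := ExpApprox.exists_eventually_one_lt s t hs ht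
  constructor
  · intro ε₃ hε
    obtain ⟨N₃, hN₃⟩ := Filter.eventually_atTop.mp (hmain.and
      (ExpApprox.tendsto_log_log_natCast.eventually (ExpApprox.mainTerm_le_mul_eps C ε₃ hε)))
    refine ⟨max N₃ 1, le_max_right _ _, fun M _ N hN => ?_⟩
    obtain ⟨h1, h2⟩ := hN₃ N ((le_max_left _ _).trans hN)
    rw [mul_div_assoc]
    exact h1 M _ h2
  · intro n hn
    obtain ⟨k, rfl⟩ : ∃ k, n = k + 2 := ⟨n - 2, by omega⟩
    obtain ⟨N₃, hN₃⟩ := Filter.eventually_atTop.mp (hmain.and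
      (ExpApprox.tendsto_log_log_natCast.eventually (ExpApprox.mainTerm_le_zIter C k)))
    refine ⟨C + 4, by positivity, max N₃ 2, by omega, fun M _ N hN => ?_⟩
    obtain ⟨h1, h2⟩ := hN₃ N ((le_max_left _ _).trans hN)
    have hN1 : (1 : ℝ) < N := by exact_mod_cast (le_max_right _ _).trans hN
    rw [Real.exp_log (Real.log_pos hN1)] at h2
    exact h1 M _ h2
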